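/- Let $\mathcal A_r$ denote the $r$-th Cayley--Dickson algebra over $\mathbb R$ (real dimension $2^r$, generators $i_0=1,i_1,\dots,i_{2^r-1}$, Euclidean norm), let $\lambda$ be a set and let $X=l_2(\lambda,\mathcal A_r)$; for a finite set $\lambda$ with $m$ elements this is $\mathcal A_r^m$. A word is a fully bracketed product of constants from $\mathcal A_r$ and of a variable $z$, and a phrase is a finite real linear combination of words. The super-differential $D$ of phrases is real linear, vanishes on constants, satisfies $Dz.h=h$ and Leibniz' rule. A function $g$ from a neighbourhood of $y\in\mathcal A_r$ to $\mathcal A_r$ is super-differentiable (locally $z$-analytic) at $y$ if on some ball around $y$ one has $g(y+h)=\sum_{n\ge0}P_n(h)$, where $P_n$ is a phrase all of whose words contain the variable exactly $n$ times, and the Fréchet derivative of $g$ over $\mathbb R$ exists on this ball and is given by $g'(y+h).v=\sum_n DP_n(h).v$. A map $f=(f^j)_j$ from an open subset $U$ of $l_2(\lambda,\mathcal A_r)$ to $l_2(\lambda',\mathcal A_r)$ is $\mathcal A_r$-holomorphic if it is real analytic on $U$ and each component $f^j$ is super-differentiable in each single variable ${}_kz\in\mathcal A_r$ at each point of $U$.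 An $\mathcal A_r$-holomorphic manifold modelled on $X$ is a Hausdorff space $M$ with an atlas of homeomorphisms $\phi_j:U_j\to\phi_j(U_j)$ from open sets covering $M$ onto open subsets of $X$, all of whose transition maps are $\mathcal A_r$-holomorphic. An $\mathcal A_r$-vector space is a real vector space $V$ with real bilinear unital left and right multiplications by $\mathcal A_r$ such that $V=\bigoplus_k X_0i_k$ for a real subspace $X_0$ with $a(xb)=x(ab)$ and $(xb)a=x(ba)$ for all $x\in X_0$ and $a,b\in\mathcal A_r$. **Proposition.** Let $M$ be an $\mathcal A_r$-holomorphic manifold modelled on $X$, with atlas $\{(U_j,\phi_j)\}_j$. Then $M$ is a real $C^\infty$-manifold, and its tangent bundle $TM$ is an $\mathcal A_r$-holomorphic manifold modelled on $X\oplus X=l_2(\lambda\sqcup\lambda,\mathcal A_r)$, with the atlas $\{(TU_j,T\phi_j)\}_j$, where $TU_j$ is the part of $TM$ over $U_j$ and $T\phi_j(x,v)=(\phi_j(x),d_x\phi_j\,v)$. Each fibre $T_xM$ is a vector space over $\mathcal A_r$: for every chart $\phi_j$ at $x$ the real vector space $T_xM$ has a structure of an $\mathcal A_r$-vector space for which $d_x\phi_j:T_xM\to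 X$ is an $\mathbb R$-linear homeomorphism and an isomorphism for the left and right multiplications by $\mathcal A_r$ (which act on $X$ entrywise); and for any two charts $\phi_j,\phi_k$ at $x$ every entry $\mathcal A_r\to\mathcal A_r$ of the real linear map $d_x\phi_k\circ(d_x\phi_j)^{-1}:X\to X$ is given by a phrase all of whose words contain the variable exactly once. -/

import Mathlib

open scoped Manifold ContDiff

noncomputable section

/-! ### The Cayley-Dickson algebras -/

/-- The set of `2 ^ r` indices of the standard generators of the `r`-th Cayley-Dickson algebra. -/
def CDIndex : ℕ → Type
  | 0 => Unit
  | r + 1 => CDIndex r ⊕ CDIndex r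

instance CDIndex.instFintype : ∀ r : ℕ, Fintype (CDIndex r)
  | 0 => inferInstanceAs (Fintype Unit)
  | r + 1 =>
    haveI := CDIndex.instFintype r
    inferInstanceAs (Fintype (CDIndex r ⊕ CDIndex r))

instance CDIndex.instDecidableEq : ∀ r : ℕ, DecidableEq (CDIndex r)
  | 0 => inferInstanceAs (DecidableEq Unit)
  | r + 1 =>
    haveI := CDIndex.instDecidableEq r
    inferInstanceAs (DecidableEq (CDIndex r ⊕ CDIndex r))

/-- The index of the generator `i₀ = 1`. -/
def CDIndex.zero : ∀ r : ℕ, CDIndex r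
  | 0 => ()
  | r + 1 => Sum.inl (CDIndex.zero r)

/-- Conjugation in coordinates: `(a, b)* = (a*, -b)`. -/
def cdConj : ∀ r : ℕ, (CDIndex r → ℝ) → (CDIndex r → ℝ)
  | 0, a => a
  | r + 1, a => Sum.elim (cdConj r (fun k => a (Sum.inl k))) (fun k => -a (Sum.inr k))

/-- Cayley-Dickson multiplication in coordinates:
`(a, b) (c, d) = (a c - d* b, d a + b c*)`, starting from the real numbers. -/
def cdMul : ∀ r : ℕ, (CDIndex r → ℝ) → (CDIndex r → ℝ) → (CDIndex r → ℝ)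
  | 0, x, y => fun k => x k * y k
  | r + 1, x, y =>
    Sum.elim
      (cdMul r (fun k => x (Sum.inl k)) (fun k => y (Sum.inl k)) -
        cdMul r (cdConj r (fun k => y (Sum.inr k))) (fun k => x (Sum.inr k)))
      (cdMul r (fun k => y (Sum.inr k)) (fun k => x (Sum.inl k)) +
        cdMul r (fun k => x (Sum.inr k)) (cdConj r (fun k => y (Sum.inl k))))

/-- The Cayley-Dickson algebra `A_r`, of real dimension `2 ^ r`, with its Euclidean norm. -/
abbrev CD (r : ℕ) : Type := EuclideanSpace ℝ (CDIndex r)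

instance CD.instMul (r : ℕ) : Mul (CD r) :=
  ⟨fun x y => WithLp.toLp 2 (cdMul r (fun k => x k) (fun k => y k))⟩

/-- The standard generators `i_k` of `A_r`. -/
def CD.gen (r : ℕ) (k : CDIndex r) : CD r := EuclideanSpace.single k 1

instance CD.instOne (r : ℕ) : One (CD r) := ⟨CD.gen r (CDIndex.zero r)⟩

/-- A vector space over `A_r`: a real vector space `V` with real bilinear left and right
multiplications by `A_r`, which is the direct sum `⨁ₖ X₀ iₖ` over the generators `iₖ`, where the
real subspace `X₀` commutes and associates with `A_r`. -/
structure CDVectorSpace (r : ℕ) (V : Type*) [AddCommGroup V] [Module ℝ V] where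
  /-- `lsmul a v` is `a v` -/
  lsmul : CD r →ₗ[ℝ] V →ₗ[ℝ] V
  /-- `rsmul a v` is `v a` -/
  rsmul : CD r →ₗ[ℝ] V →ₗ[ℝ] V
  one_lsmul : ∀ v, lsmul 1 v = v
  one_rsmul : ∀ v, rsmul 1 v = v
  /-- the real subspace `X₀` -/
  core : Submodule ℝ V
  lsmul_core : ∀ (a b : CD r), ∀ v ∈ core, lsmul a (rsmul b v) = rsmul (a * b) v
  rsmul_core : ∀ (a b : CD r), ∀ v ∈ core, rsmul a (rsmul b v) = rsmul (b * a) v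
  decomposition : ∀ v : V, ∃! c : CDIndex r → core, v = ∑ k, rsmul (CD.gen r k) (c k : V)

/-! ### Words, phrases, and super-differentiability in one Cayley-Dickson variable -/

/-- Words in one variable `z` with constants in `A_r`; the order of all multiplications is part of
the word, since `A_r` need be neither commutative nor associative. -/
inductive CDWord (r : ℕ) : Type
  | const (a : CD r) : CDWord r
  | var : CDWord r
  | mul (u v : CDWord r) : CDWord r

namespace CDWord

/-- The value of a word at `z`. -/
def eval {r : ℕ} (z : CD r) : CDWord r → CD r
  | const a => a
  | var => z
  | mul u v => u.eval z * v.eval z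

/-- The number of occurrences of the variable. -/
def degree {r : ℕ} : CDWord r → ℕ
  | const _ => 0
  | var => 1
  | mul u v => u.degree + v.degree

/-- The value at `z`, in the direction `h`, of the super-differential of a word:
constants have differential `0`, `D z . h = h`, and Leibniz' rule holds. -/
def diff {r : ℕ} (z h : CD r) : CDWord r → CD r
  | const _ => 0
  | var => h
  | mul u v => u.diff z h * v.eval z + u.eval z * v.diff z h

end CDWord

/-- Phrases: formal finite real linear combinations of words. -/
abbrev CDPhrase (r : ℕ) : Type := CDWord r →₀ ℝ

namespace CDPhrase

/-- The value of a phrase at `z`. -/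
def eval {r : ℕ} (P : CDPhrase r) (z : CD r) : CD r := P.sum fun w c => c • w.eval z

/-- The super-differential of a phrase: the real linear extension of that of words. -/
def diff {r : ℕ} (P : CDPhrase r) (z h : CD r) : CD r := P.sum fun w c => c • w.diff z h

/-- All words of the phrase contain the variable exactly `n` times. -/
def IsHomogeneous {r : ℕ} (P : CDPhrase r) (n : ℕ) : Prop := ∀ w ∈ P.support, w.degree = n

end CDPhrase

/-- `g` is super-differentiable (locally `z`-analytic) at `y`: on a ball around `y` it is the sum
of a series of phrases in `z - y`, and its Fréchet derivative over `ℝ` exists there and is the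
super-differential of the series. -/
def SuperDifferentiableAt {r : ℕ} (g : CD r → CD r) (y : CD r) : Prop :=
  ∃ P : ℕ → CDPhrase r, (∀ n, (P n).IsHomogeneous n) ∧
    ∃ ρ : ℝ, 0 < ρ ∧ ∀ h : CD r, ‖h‖ < ρ →
      HasSum (fun n => (P n).eval h) (g (y + h)) ∧
      ∃ D : CD r →L[ℝ] CD r, HasFDerivAt g D (y + h) ∧
        ∀ v : CD r, HasSum (fun n => (P n).diff h v) (D v)

/-! ### Holomorphic maps between the spaces `l₂(ι, A_r)` -/

/-- The Hilbert space `l₂(ι, A_r)`; for a finite set `ι` with `m` elements it is `A_r ^ m`. -/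
abbrev CDSpace (r : ℕ) (ι : Type*) : Type _ := lp (fun _ : ι => CD r) 2

/-- The vector of `l₂(ι, A_r)` with entry `ζ` at `k` and all other entries `0`. -/
def CDSpace.coord {r : ℕ} {ι : Type*} (k : ι) (ζ : CD r) : CDSpace r ι :=
  letI := Classical.decEq ι
  lp.single 2 k ζ

/-- `f` is `A_r`-holomorphic on `U`: it is analytic over `ℝ` at every point of `U`, and each of its
components is super-differentiable in each of the Cayley-Dickson variables. -/
def CDHolomorphicOn {r : ℕ} {ι κ : Type*} (f : CDSpace r ι → CDSpace r κ)
    (U : Set (CDSpace r ι)) : Prop :=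
  ∀ z ∈ U, AnalyticAt ℝ f z ∧
    ∀ (j : κ) (k : ι), SuperDifferentiableAt (fun ζ : CD r => f (z + CDSpace.coord k ζ) j) 0

/-- A real linear map all of whose matrix entries are phrases in which the variable occurs
exactly once; the kind of map that the super-differential of a holomorphic map is. -/
def IsSuperlinear {r : ℕ} {ι κ : Type*} (L : CDSpace r ι →L[ℝ] CDSpace r κ) : Prop :=
  ∀ (j : κ) (k : ι), ∃ P : CDPhrase r, P.IsHomogeneous 1 ∧
    ∀ ζ : CD r, L (CDSpace.coord k ζ) j = P.eval ζ

/-! ### Holomorphic manifolds -/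

/-- A topological space with an atlas modelled on `l₂(ι, A_r)` is an `A_r`-holomorphic manifold: it
is Hausdorff and all transition maps are `A_r`-holomorphic. -/
structure IsCDManifold (r : ℕ) (ι : Type*) (M : Type*) [TopologicalSpace M]
    [ChartedSpace (CDSpace r ι) M] : Prop where
  t2 : T2Space M
  holomorphic : ∀ e ∈ atlas (CDSpace r ι) M, ∀ e' ∈ atlas (CDSpace r ι) M,
    CDHolomorphicOn (e.symm.trans e' : CDSpace r ι → CDSpace r ι) (e.symm.trans e').source

/-- The differential `T_xM → X` of a chart `e` at the point `x`. -/
def chartDifferential {r : ℕ} {ι : Type*} {M : Type*} [TopologicalSpace M]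
    [ChartedSpace (CDSpace r ι) M] (e : OpenPartialHomeomorph M (CDSpace r ι)) (x : M) :
    TangentSpace 𝓘(ℝ, CDSpace r ι) x →L[ℝ] CDSpace r ι :=
  mfderiv 𝓘(ℝ, CDSpace r ι) 𝓘(ℝ, CDSpace r ι) e x

/-- `E` is the chart `Te` of the tangent bundle induced by the chart `e`: it is defined over the
domain of `e` and sends a tangent vector `v` at `x` to `(e x, de_x v)`, the two halves being
written as the two blocks of coordinates of `l₂(ι ⊕ ι, A_r)`. -/
def IsTangentChart {r : ℕ} {ι : Type*} {M : Type*} [TopologicalSpace M]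
    [ChartedSpace (CDSpace r ι) M] [IsManifold 𝓘(ℝ, CDSpace r ι) 1 M]
    (e : OpenPartialHomeomorph M (CDSpace r ι))
    (E : OpenPartialHomeomorph (TangentBundle 𝓘(ℝ, CDSpace r ι) M) (CDSpace r (ι ⊕ ι))) : Prop :=
  E.source = {p | p.proj ∈ e.source} ∧
    ∀ p ∈ E.source, ∀ k : ι,
      E p (Sum.inl k) = e p.proj k ∧
      E p (Sum.inr k) = chartDifferential e p.proj p.snd k

end

/-! ### Algebra of the Cayley-Dickson multiplication -/

noncomputable section

/-! The transition maps of the charts `Te` are the tangent maps `(z, v) ↦ (f z, f'(z) v)` of the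
transition maps `f` of `M`, so everything rests on tangent maps of holomorphic maps being
holomorphic (`CDHolomorphicOn.tangentMap`).

For a real analytic function, super-differentiability at a point amounts to every Taylor term there
being a homogeneous phrase (`SuperDifferentiableAt.iteratedFDeriv_mem`,
`AnalyticAt.superDifferentiableAt`). Homogeneous expansions are unique, and the demand on the
derivative is automatic: the super-differential of a phrase is its Fréchet derivative, and Taylor
series differentiate termwise.

The crux is `z ↦ f'(z) v` in one variable of `z`, with `v` an arbitrary vector. By symmetry of
higher derivatives its `n`-th Taylor term is the derivative along `v` of the `n`-th Taylor term of
`f`. It is thus a limit of difference quotients of phrases of degree `n`, and such phrases form a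
closed set because the multilinear maps on `A_r` have finite dimension. In the variables of `v` the
map is linear, with entries the first Taylor terms of `f`, which are phrases of degree one.

The fibres receive the entrywise structure of the model space, transported along the differential of
a chart. -/

theorem cdConj_add (r : ℕ) (x y : CDIndex r → ℝ) :
    cdConj r (x + y) = cdConj r x + cdConj r y := by
  induction r with
  | zero => rfl
  | succ r ih =>
    funext k
    rcases k with k | k
    · exact congrFun (ih (fun k => x (Sum.inl k)) (fun k => y (Sum.inl k))) k
    · exact neg_add _ _

theorem cdConj_smul (r : ℕ) (c : ℝ) (x : CDIndex r → ℝ) :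
    cdConj r (c • x) = c • cdConj r x := by
  induction r with
  | zero => rfl
  | succ r ih =>
    funext k
    rcases k with k | k
    · exact congrFun (ih (fun k => x (Sum.inl k))) k
    · exact (mul_neg _ _).symm

/-- The doubling formula reverses the order of some factors, so the induction for either slot needs
the hypothesis for both. -/
theorem cdMul_add_left_right (r : ℕ) (x x' y : CDIndex r → ℝ) :
    cdMul r (x + x') y = cdMul r x y + cdMul r x' y ∧
      cdMul r y (x + x') = cdMul r y x + cdMul r y x' := by
  induction r with
  | zero => exact ⟨funext fun k => add_mul _ _ _, funext fun k => mul_add _ _ _⟩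
  | succ r ih =>
    have hl : (fun k => (x + x') (Sum.inl k) : CDIndex r → ℝ) =
      (fun k => x (Sum.inl k)) + fun k => x' (Sum.inl k) := rfl
    have hr : (fun k => (x + x') (Sum.inr k) : CDIndex r → ℝ) =
      (fun k => x (Sum.inr k)) + fun k => x' (Sum.inr k) := rfl
    constructor
    · funext k
      rcases k with k | k
      all_goals
        change cdMul (r + 1) (x + x') y _ = cdMul (r + 1) x y _ + cdMul (r + 1) x' y _
        simp only [cdMul, hl, hr, (ih _ _ _).1, (ih _ _ _).2, Sum.elim_inl, Sum.elim_inr,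
          Pi.add_apply, Pi.sub_apply]
        ring
    · funext k
      rcases k with k | k
      all_goals
        change cdMul (r + 1) y (x + x') _ = cdMul (r + 1) y x _ + cdMul (r + 1) y x' _
        simp only [cdMul, hl, hr, cdConj_add, (ih _ _ _).1, (ih _ _ _).2, Sum.elim_inl,
          Sum.elim_inr, Pi.add_apply, Pi.sub_apply]
        ring

theorem cdMul_smul_left_right (r : ℕ) (c : ℝ) (x y : CDIndex r → ℝ) :
    cdMul r (c • x) y = c • cdMul r x y ∧ cdMul r y (c • x) = c • cdMul r y x := by
  induction r with
  | zero => exact ⟨funext fun k => mul_assoc _ _ _, funext fun k => mul_left_comm _ _ _⟩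
  | succ r ih =>
    have hl : (fun k => (c • x) (Sum.inl k) : CDIndex r → ℝ) = c • fun k => x (Sum.inl k) := rfl
    have hr : (fun k => (c • x) (Sum.inr k) : CDIndex r → ℝ) = c • fun k => x (Sum.inr k) := rfl
    constructor
    · funext k
      rcases k with k | k
      all_goals
        change cdMul (r + 1) (c • x) y _ = c * cdMul (r + 1) x y _
        simp only [cdMul, hl, hr, (ih _ _).1, (ih _ _).2, Sum.elim_inl, Sum.elim_inr,
          Pi.add_apply, Pi.sub_apply, Pi.smul_apply, smul_eq_mul]
        ring
    · funext k
      rcases k with k | k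
      all_goals
        change cdMul (r + 1) y (c • x) _ = c * cdMul (r + 1) y x _
        simp only [cdMul, hl, hr, cdConj_smul, (ih _ _).1, (ih _ _).2, Sum.elim_inl,
          Sum.elim_inr, Pi.add_apply, Pi.sub_apply, Pi.smul_apply, smul_eq_mul]
        ring

/-- The coordinates of the unit. -/
def cdOne (r : ℕ) : CDIndex r → ℝ := Pi.single (CDIndex.zero r) 1

theorem cdOne_succ (r : ℕ) : cdOne (r + 1) = Sum.elim (cdOne r) (0 : CDIndex r → ℝ) := by
  funext k
  rcases k with k | k
  · exact (Pi.single_apply _ _ _).trans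
      ((if_congr Sum.inl_injective.eq_iff rfl rfl).trans (Pi.single_apply _ _ _).symm)
  · exact (Pi.single_apply _ _ _).trans (if_neg Sum.inr_ne_inl)

theorem cdConj_cdOne (r : ℕ) : cdConj r (cdOne r) = cdOne r := by
  induction r with
  | zero => rfl
  | succ r ih =>
    rw [cdOne_succ]
    funext k
    rcases k with k | k
    · exact congrFun ih k
    · simp [cdConj]

theorem cdMul_zero_left_right (r : ℕ) (x : CDIndex r → ℝ) :
    cdMul r 0 x = 0 ∧ cdMul r x 0 = 0 := by
  simpa using cdMul_smul_left_right r 0 0 x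

theorem cdConj_zero (r : ℕ) : cdConj r 0 = 0 := by simpa using cdConj_smul r 0 0

theorem cdMul_cdOne (r : ℕ) (x : CDIndex r → ℝ) :
    cdMul r (cdOne r) x = x ∧ cdMul r x (cdOne r) = x := by
  induction r with
  | zero =>
    have this (k : CDIndex 0) : cdOne 0 k = 1 := rfl
    exact ⟨funext fun k => by simp [cdMul, this], funext fun k => by simp [cdMul, this]⟩
  | succ r ih =>
    rw [cdOne_succ]
    have h0 : (fun _ => 0 : CDIndex r → ℝ) = 0 := rfl
    constructor
    · funext k
      rcases k with k | k <;>
        simp [cdMul, h0, ih, cdMul_zero_left_right]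
    · funext k
      rcases k with k | k <;>
        simp [cdMul, h0, ih, cdMul_zero_left_right, cdConj_zero, cdConj_cdOne]

namespace CD

variable {r : ℕ}

theorem mul_def (x y : CD r) : x * y = WithLp.toLp 2 (cdMul r x.ofLp y.ofLp) := rfl

theorem mul_add' (x y z : CD r) : x * (y + z) = x * y + x * z := by
  simp only [mul_def, WithLp.ofLp_add, (cdMul_add_left_right r _ _ _).2, WithLp.toLp_add]

theorem add_mul' (x y z : CD r) : (x + y) * z = x * z + y * z := by
  simp only [mul_def, WithLp.ofLp_add, (cdMul_add_left_right r _ _ _).1, WithLp.toLp_add]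

theorem smul_mul (c : ℝ) (x y : CD r) : (c • x) * y = c • (x * y) := by
  simp only [mul_def, WithLp.ofLp_smul, (cdMul_smul_left_right r _ _ _).1, WithLp.toLp_smul]

theorem mul_smul' (c : ℝ) (x y : CD r) : x * (c • y) = c • (x * y) := by
  simp only [mul_def, WithLp.ofLp_smul, (cdMul_smul_left_right r _ _ _).2, WithLp.toLp_smul]

theorem ofLp_one : (1 : CD r).ofLp = cdOne r := rfl

theorem one_mul' (x : CD r) : 1 * x = x := by
  rw [mul_def, ofLp_one, (cdMul_cdOne r _).1]

theorem mul_one' (x : CD r) : x * 1 = x := by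
  rw [mul_def, ofLp_one, (cdMul_cdOne r _).2]

/-- Multiplication as a real bilinear map. -/
def mulLin (r : ℕ) : CD r →ₗ[ℝ] CD r →ₗ[ℝ] CD r :=
  LinearMap.mk₂ ℝ (· * ·) add_mul' smul_mul mul_add' mul_smul'

/-- Multiplication as a continuous real bilinear map. -/
def mulL (r : ℕ) : CD r →L[ℝ] CD r →L[ℝ] CD r :=
  LinearMap.toContinuousLinearMap
    ((LinearMap.toContinuousLinearMap : (CD r →ₗ[ℝ] CD r) ≃ₗ[ℝ] _).toLinearMap ∘ₗ mulLin r)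

@[simp] theorem mulL_apply (x y : CD r) : mulL r x y = x * y := rfl

end CD

/-! ### Evaluation and differentiation of phrases -/

namespace CDWord

variable {r : ℕ}

/-- The product rule for a continuous bilinear map is exactly the Leibniz clause of `diff`; neither
commutativity nor associativity is needed. -/
theorem hasFDerivAt_eval (w : CDWord r) (z : CD r) :
    ∃ D : CD r →L[ℝ] CD r, HasFDerivAt (fun z => w.eval z) D z ∧ ∀ h, D h = w.diff z h := by
  induction w with
  | const a => exact ⟨0, hasFDerivAt_const _ _, fun _ => rfl⟩
  | var => exact ⟨.id ℝ _, hasFDerivAt_id _, fun _ => rfl⟩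
  | mul u v hu hv =>
    obtain ⟨Du, hDu, hu⟩ := hu
    obtain ⟨Dv, hDv, hv⟩ := hv
    refine ⟨_, (CD.mulL r).hasFDerivAt_of_bilinear hDu hDv, fun h => ?_⟩
    simp [diff, hu, hv, add_comm]

theorem eval_smul (w : CDWord r) (t : ℝ) (z : CD r) :
    w.eval (t • z) = t ^ w.degree • w.eval z := by
  induction w with
  | const a => simp [eval, degree]
  | var => simp [eval, degree]
  | mul u v hu hv =>
    simp only [eval, degree, hu, hv, CD.smul_mul, CD.mul_smul', smul_smul, pow_add, mul_comm]

end CDWord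

namespace CDPhrase

variable {r : ℕ}

theorem hasFDerivAt_eval (P : CDPhrase r) (z : CD r) :
    ∃ D : CD r →L[ℝ] CD r, HasFDerivAt P.eval D z ∧ ∀ h, D h = P.diff z h := by
  choose D hD hD' using fun w : CDWord r => w.hasFDerivAt_eval z
  refine ⟨∑ w ∈ P.support, P w • D w, ?_, fun h => ?_⟩
  · exact HasFDerivAt.fun_sum fun w _ => (hD w).const_smul (P w)
  · simp [diff, Finsupp.sum, hD']

theorem eval_smul {P : CDPhrase r} {n : ℕ} (hP : P.IsHomogeneous n) (t : ℝ) (z : CD r) :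
    P.eval (t • z) = t ^ n • P.eval z := by
  simp only [eval, Finsupp.sum, Finset.smul_sum]
  refine Finset.sum_congr rfl fun w hw => ?_
  rw [CDWord.eval_smul, hP w hw, smul_comm]

theorem eval_add (P Q : CDPhrase r) (z : CD r) : (P + Q).eval z = P.eval z + Q.eval z :=
  Finsupp.sum_add_index' (by simp) (by simp [add_smul])

theorem eval_const_smul (c : ℝ) (P : CDPhrase r) (z : CD r) : (c • P).eval z = c • P.eval z := by
  simp only [eval]
  rw [Finsupp.sum_smul_index (by simp), Finsupp.smul_sum]
  simp [mul_smul]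

@[simp] theorem eval_zero (z : CD r) : (0 : CDPhrase r).eval z = 0 := Finsupp.sum_zero_index

@[simp] theorem diff_zero (z h : CD r) : (0 : CDPhrase r).diff z h = 0 := Finsupp.sum_zero_index

theorem isHomogeneous_zero (n : ℕ) : (0 : CDPhrase r).IsHomogeneous n := fun w hw => by simp at hw

theorem IsHomogeneous.add {P Q : CDPhrase r} {n : ℕ} (hP : P.IsHomogeneous n)
    (hQ : Q.IsHomogeneous n) : (P + Q).IsHomogeneous n := fun w hw => by
  classical
  exact (Finset.mem_union.1 (Finsupp.support_add hw)).elim (hP w) (hQ w)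

theorem IsHomogeneous.smul {P : CDPhrase r} {n : ℕ} (hP : P.IsHomogeneous n) (c : ℝ) :
    (c • P).IsHomogeneous n := fun w hw => hP w (Finsupp.support_smul hw)

end CDPhrase

/-- The real vector space of the maps given by phrases of degree `n`. -/
def phraseMaps (r n : ℕ) : Submodule ℝ (CD r → CD r) where
  carrier := {F | ∃ P : CDPhrase r, P.IsHomogeneous n ∧ ∀ h, F h = P.eval h}
  add_mem' := by
    rintro F G ⟨P, hP, hF⟩ ⟨Q, hQ, hG⟩
    exact ⟨P + Q, hP.add hQ, fun h => by simp [hF, hG, CDPhrase.eval_add]⟩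
  zero_mem' := ⟨0, CDPhrase.isHomogeneous_zero n, fun h => by simp⟩
  smul_mem' := by
    rintro c F ⟨P, hP, hF⟩
    exact ⟨c • P, hP.smul c, fun h => by simp [hF, CDPhrase.eval_const_smul]⟩

/-- The continuous multilinear maps whose restriction to the diagonal is given by a phrase. -/
def phraseMultilinear (r n : ℕ) : Submodule ℝ (CD r [×n]→L[ℝ] CD r) where
  carrier := {m | (fun h => m fun _ => h) ∈ phraseMaps r n}
  add_mem' := fun ha hb => (phraseMaps r n).add_mem ha hb
  zero_mem' := (phraseMaps r n).zero_mem
  smul_mem' := fun c _ ha => (phraseMaps r n).smul_mem c ha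

/-- Every subspace of a finite-dimensional space is closed. This is what makes a limit of phrases of
fixed degree again a phrase. -/
theorem isClosed_phraseMultilinear (r n : ℕ) :
    IsClosed (phraseMultilinear r n : Set (CD r [×n]→L[ℝ] CD r)) := by
  have : FiniteDimensional ℝ (CD r [×n]→L[ℝ] CD r) :=
    FiniteDimensional.of_injective
      (ContinuousMultilinearMap.toMultilinearMapLinear :
        (CD r [×n]→L[ℝ] CD r) →ₗ[ℝ] MultilinearMap ℝ (fun _ : Fin n => CD r) (CD r))
      ContinuousMultilinearMap.toMultilinearMap_injective
  exact Submodule.closed_of_finiteDimensional _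

/-! ### Taylor terms of real analytic maps -/

section Taylor

open scoped Nat Topology

variable {E F G : Type*} [NormedAddCommGroup E] [NormedSpace ℝ E] [NormedAddCommGroup F]
  [NormedSpace ℝ F] [NormedAddCommGroup G] [NormedSpace ℝ G]

/-- A sum of a power series in one variable, given by its coefficients. -/
theorem hasFPowerSeriesAt_mkPiRing {c : ℝ → F} {a : ℕ → F} {x : ℝ}
    (ha : ∀ᶠ t : ℝ in 𝓝 0, HasSum (fun n => t ^ n • a n) (c (x + t))) :
    HasFPowerSeriesAt c
      (show FormalMultilinearSeries ℝ ℝ F from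
        fun n => ContinuousMultilinearMap.mkPiRing ℝ (Fin n) (a n)) x := by
  rw [hasFPowerSeriesAt_iff]
  filter_upwards [ha] with t ht
  simpa [FormalMultilinearSeries.coeff] using ht

theorem tendsto_smul_const_zero (h : E) :
    Filter.Tendsto (fun t : ℝ => t • h) (𝓝 0) (𝓝 0) := by
  have : Continuous fun t : ℝ => t • h := by fun_prop
  simpa using this.tendsto 0

theorem ContinuousMultilinearMap.diag_smul {n : ℕ} (m : E [×n]→L[ℝ] F) (t : ℝ) (h : E) :
    (m fun _ => t • h) = t ^ n • m fun _ => h := by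
  simpa using m.map_smul_univ (fun _ => t) fun _ => h

theorem iteratedFDeriv_fderiv_snoc {f : E → F} {x : E}
    (n : ℕ) (u v : E) :
    iteratedFDeriv ℝ n (fderiv ℝ f) x (fun _ => u) v =
      iteratedFDeriv ℝ (n + 1) f x (Fin.snoc (α := fun _ => E) (fun _ : Fin n => u) v) := by
  simp [iteratedFDeriv_succ_apply_right]

variable [CompleteSpace F]

theorem AnalyticAt.eventually_hasSum_iteratedFDeriv {g : E → F} {y : E} (hg : AnalyticAt ℝ g y) :
    ∀ᶠ h in 𝓝 (0 : E),
      HasSum (fun n => (n ! : ℝ)⁻¹ • iteratedFDeriv ℝ n g y fun _ => h) (g (y + h)) := by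
  obtain ⟨p, R, hp⟩ := hg
  filter_upwards [Metric.eball_mem_nhds (0 : E) hp.r_pos] with h hh
  exact hp.hasSum_iteratedFDeriv hh

/-- Expansions into homogeneous terms of an analytic function are unique. -/
theorem AnalyticAt.iteratedFDeriv_eq_of_hasSum {g : E → F} {y : E} (hg : AnalyticAt ℝ g y)
    {q : ℕ → E → F} (hq : ∀ n (t : ℝ) h, q n (t • h) = t ^ n • q n h)
    (hs : ∀ᶠ h in 𝓝 (0 : E), HasSum (fun n => q n h) (g (y + h))) (n : ℕ) (h : E) :
    (n ! : ℝ)⁻¹ • iteratedFDeriv ℝ n g y (fun _ => h) = q n h := by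
  -- On the line `t ↦ y + t • h` both expansions become power series in the real variable `t`, whose
  -- coefficients are unique.
  have h1 := hasFPowerSeriesAt_mkPiRing (c := fun t : ℝ => g (y + t • h)) (x := 0)
    (a := fun n => (n ! : ℝ)⁻¹ • iteratedFDeriv ℝ n g y fun _ => h) (by
      filter_upwards [(tendsto_smul_const_zero h).eventually hg.eventually_hasSum_iteratedFDeriv]
        with t ht
      simpa only [ContinuousMultilinearMap.diag_smul, smul_comm ((_ ! : ℝ)⁻¹), zero_add] using ht)
  have h2 := hasFPowerSeriesAt_mkPiRing (c := fun t : ℝ => g (y + t • h)) (x := 0)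
    (a := fun n => q n h) (by
      filter_upwards [(tendsto_smul_const_zero h).eventually hs] with t ht
      simpa only [hq, zero_add] using ht)
  have := congrArg (fun p : FormalMultilinearSeries ℝ ℝ F => p n fun _ => 1)
    (h1.eq_formalMultilinearSeries h2)
  simpa using this

/-- The diagonal terms of the Taylor series of a composition with an affine map. -/
theorem AnalyticAt.iteratedFDeriv_comp_affine {f : E → F} {x : E} (hf : AnalyticAt ℝ f x)
    (L : G →L[ℝ] E) (n : ℕ) (h : G) :
    iteratedFDeriv ℝ n (fun ζ => f (x + L ζ)) 0 (fun _ => h) =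
      iteratedFDeriv ℝ n f x fun _ => L h := by
  have hL : AnalyticAt ℝ (fun ζ => f (x + L ζ)) 0 :=
    AnalyticAt.fun_comp (by simpa using hf) (analyticAt_const.add (L.analyticAt 0))
  -- Substituting `L h` into the Taylor series of `f` gives a homogeneous expansion of the
  -- composite; uniqueness identifies the terms.
  have := hL.iteratedFDeriv_eq_of_hasSum
    (q := fun n h => (n ! : ℝ)⁻¹ • iteratedFDeriv ℝ n f x fun _ => L h)
    (fun n t h => by simp only [map_smul]; rw [ContinuousMultilinearMap.diag_smul, smul_comm]) (by
      have h0 : Filter.Tendsto L (𝓝 0) (𝓝 0) := by simpa using L.continuous.tendsto 0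
      filter_upwards [h0.eventually hf.eventually_hasSum_iteratedFDeriv] with h hh
      simpa using hh) n h
  exact smul_right_injective F (inv_ne_zero (by positivity : (n ! : ℝ) ≠ 0)) this

/-- The Taylor terms of a directional derivative. -/
theorem AnalyticAt.iteratedFDeriv_fderiv_apply_const {f : E → F} {x : E} (hf : AnalyticAt ℝ f x)
    (n : ℕ) (u v : E) :
    iteratedFDeriv ℝ n (fun z => fderiv ℝ f z v) x (fun _ => u) =
      iteratedFDeriv ℝ n (fderiv ℝ f) x (fun _ => u) v := by
  have hv : AnalyticAt ℝ (fun z => fderiv ℝ f z v) x :=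
    ((ContinuousLinearMap.apply ℝ F v).analyticAt _).comp hf.fderiv
  have := hv.iteratedFDeriv_eq_of_hasSum
    (q := fun n h => (n ! : ℝ)⁻¹ • iteratedFDeriv ℝ n (fderiv ℝ f) x (fun _ => h) v)
    (fun n t h => by
      rw [ContinuousMultilinearMap.diag_smul, smul_apply, smul_comm]) (by
      filter_upwards [hf.fderiv.eventually_hasSum_iteratedFDeriv] with h hh
      simpa using (ContinuousLinearMap.apply ℝ F v).hasSum hh) n u
  exact smul_right_injective F (inv_ne_zero (by positivity : (n ! : ℝ) ≠ 0)) this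

/-- Directional derivatives commute with Taylor terms. -/
theorem AnalyticAt.iteratedFDeriv_fderiv_apply {f : E → F} {x : E} (hf : AnalyticAt ℝ f x)
    (n : ℕ) (u v : E) :
    iteratedFDeriv ℝ n (fun z => fderiv ℝ f z v) x (fun _ => u) =
      fderiv ℝ (iteratedFDeriv ℝ n f) x v fun _ => u := by
  -- Differentiating last puts `v` in the first slot, differentiating first puts it in the last;
  -- symmetry under the cyclic rotation of the slots identifies the two.
  have h2 := iteratedFDeriv_succ_apply_left (𝕜 := ℝ) (f := f) (x := x)
    (Fin.cons (α := fun _ => E) v (fun _ : Fin n => u))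
  simp only [Fin.cons_zero, Fin.tail_cons] at h2
  rw [hf.iteratedFDeriv_fderiv_apply_const, iteratedFDeriv_fderiv_snoc, ← h2,
    Fin.snoc_eq_cons_rotate]
  exact hf.contDiffAt.iteratedFDeriv_comp_perm _ (finRotate (n + 1))

/-- The derivative of a Taylor term. -/
theorem AnalyticAt.hasFDerivAt_iteratedFDeriv_diag {f : E → F} {x : E} (hf : AnalyticAt ℝ f x)
    (n : ℕ) (h : E) :
    ∃ D : E →L[ℝ] F, HasFDerivAt (fun u => iteratedFDeriv ℝ (n + 1) f x fun _ => u) D h ∧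
      ∀ v, D v = ((n + 1 : ℕ) : ℝ) • iteratedFDeriv ℝ n (fderiv ℝ f) x (fun _ => h) v := by
  refine ⟨_, ((iteratedFDeriv ℝ (n + 1) f x).hasFDerivAt (fun _ => h)).comp h
    (ContinuousLinearMap.pi fun _ : Fin (n + 1) => ContinuousLinearMap.id ℝ E).hasFDerivAt,
    fun v => ?_⟩
  -- The derivative of the diagonal is a sum over the slot that receives `v`. Swapping that slot
  -- with the last shows that all `n + 1` summands agree.
  have (i : Fin (n + 1)) : iteratedFDeriv ℝ (n + 1) f x (Function.update (fun _ => h) i v) =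
      iteratedFDeriv ℝ n (fderiv ℝ f) x (fun _ => h) v := by
    rw [iteratedFDeriv_fderiv_snoc,
      ← hf.contDiffAt.iteratedFDeriv_comp_perm _ (Equiv.swap i (Fin.last n))]
    congr 1
    funext k
    refine Fin.lastCases ?_ (fun k => ?_) k
    · simp
    · rw [Fin.snoc_castSucc, Function.comp_apply, Function.update_of_ne]
      intro hk
      have := (Equiv.swap_apply_eq_iff).1 hk
      rw [Equiv.swap_apply_left] at this
      exact (Fin.castSucc_lt_last k).ne this
  simp [ContinuousMultilinearMap.linearDeriv_apply, this, ← Nat.cast_smul_eq_nsmul ℝ]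

end Taylor

/-! ### Super-differentiability through Taylor terms -/

section SuperDifferentiability

open scoped Nat Topology

variable {r : ℕ}

namespace CDPhrase

theorem IsHomogeneous.diff_eq_zero {P : CDPhrase r} (hP : P.IsHomogeneous 0) (h v : CD r) :
    P.diff h v = 0 := by
  obtain ⟨D, hD, hD'⟩ := P.hasFDerivAt_eval h
  -- Homogeneity with scalar `0`, where `0 ^ 0 = 1`, makes the phrase constant.
  have : P.eval = fun _ => P.eval 0 := funext fun z => by
    simpa using (eval_smul hP 0 z).symm
  rw [this] at hD
  rw [← hD', hD.unique (hasFDerivAt_const _ _), zero_apply]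

/-- A phrase of degree one is real linear, and is its own differential. -/
theorem IsHomogeneous.exists_clm {P : CDPhrase r} (hP : P.IsHomogeneous 1) :
    ∃ D : CD r →L[ℝ] CD r, P.eval = D ∧ ∀ h v, P.diff h v = D v := by
  obtain ⟨D, hD, -⟩ := P.hasFDerivAt_eval 0
  -- A map homogeneous of degree one and differentiable at `0` equals its derivative there: compare
  -- derivatives along `t • z`.
  have heq : P.eval = D := by
    funext z
    have h1 : HasDerivAt (fun t : ℝ => t • z) z 0 := by
      simpa using (hasDerivAt_id (0 : ℝ)).smul_const z
    have h2 : HasDerivAt (fun t : ℝ => P.eval (t • z)) (D z) 0 :=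
      HasFDerivAt.comp_hasDerivAt (l := P.eval) (l' := D) (0 : ℝ) (by simpa using hD) h1
    have h3 : HasDerivAt (fun t : ℝ => P.eval (t • z)) (P.eval z) 0 := by
      simpa [eval_smul hP] using (hasDerivAt_id (0 : ℝ)).smul_const (P.eval z)
    exact h3.unique h2
  refine ⟨D, heq, fun h v => ?_⟩
  obtain ⟨T, hT, hT'⟩ := P.hasFDerivAt_eval h
  rw [heq] at hT
  rw [← hT', hT.unique D.hasFDerivAt]

end CDPhrase

/-- The Taylor terms of a super-differentiable function are phrases. -/
theorem SuperDifferentiableAt.iteratedFDeriv_mem {g : CD r → CD r} {y : CD r}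
    (h : SuperDifferentiableAt g y) (hg : AnalyticAt ℝ g y) (n : ℕ) :
    iteratedFDeriv ℝ n g y ∈ phraseMultilinear r n := by
  obtain ⟨P, hP, ρ, hρ, hs⟩ := h
  have key := hg.iteratedFDeriv_eq_of_hasSum (q := fun n h => (P n).eval h)
    (fun n t h => CDPhrase.eval_smul (hP n) t h) (by
      filter_upwards [Metric.ball_mem_nhds (0 : CD r) hρ] with h hh
      exact (hs h (by simpa using hh)).1) n
  have : (n ! : ℝ)⁻¹ • iteratedFDeriv ℝ n g y ∈ phraseMultilinear r n := ⟨P n, hP n, key⟩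
  exact ((phraseMultilinear r n).smul_mem_iff (by positivity)).1 this

/-- An analytic function all of whose Taylor terms are phrases is super-differentiable. -/
theorem AnalyticAt.superDifferentiableAt {g : CD r → CD r} {y : CD r} (hg : AnalyticAt ℝ g y)
    (hP : ∀ n, iteratedFDeriv ℝ n g y ∈ phraseMultilinear r n) : SuperDifferentiableAt g y := by
  choose P hP hPg using fun n => (phraseMultilinear r n).smul_mem (n ! : ℝ)⁻¹ (hP n)
  have hdiff : ∀ᶠ h in 𝓝 (0 : CD r), DifferentiableAt ℝ g (y + h) := by
    have : Filter.Tendsto (fun h => y + h) (𝓝 (0 : CD r)) (𝓝 y) := by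
      have : Continuous fun h => y + h := by fun_prop
      simpa using this.tendsto 0
    exact this.eventually (hg.eventually_analyticAt.mono fun z hz => hz.differentiableAt)
  obtain ⟨ρ, hρ, hball⟩ := Metric.eventually_nhds_iff.1
    ((hg.eventually_hasSum_iteratedFDeriv.and hg.fderiv.eventually_hasSum_iteratedFDeriv).and hdiff)
  refine ⟨P, hP, ρ, hρ, fun h hh => ?_⟩
  obtain ⟨⟨h1, h2⟩, h3⟩ := hball (y := h) (by simpa using hh)
  refine ⟨h1.congr_fun fun n => (hPg n h).symm, fderiv ℝ g (y + h), h3.hasFDerivAt, fun v => ?_⟩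
  -- Both sides are derivatives of the Taylor term of degree `n + 1`; the factor is `(n + 1) / (n +
  -- 1)! = 1 / n !`.
  have hsucc (n : ℕ) : (P (n + 1)).diff h v =
      (n ! : ℝ)⁻¹ • iteratedFDeriv ℝ n (fderiv ℝ g) y (fun _ => h) v := by
    obtain ⟨D, hD, hD'⟩ := (P (n + 1)).hasFDerivAt_eval h
    obtain ⟨T, hT, hT'⟩ := hg.hasFDerivAt_iteratedFDeriv_diag n h
    have hT := hT.const_smul (((n + 1)! : ℕ) : ℝ)⁻¹
    have heq : (P (n + 1)).eval =
        fun u => (((n + 1)! : ℕ) : ℝ)⁻¹ • iteratedFDeriv ℝ (n + 1) g y fun _ => u :=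
      funext fun u => (hPg (n + 1) u).symm
    rw [heq] at hD
    rw [← hD', hD.unique hT, smul_apply, hT', smul_smul, Nat.factorial_succ]
    congr 1
    push_cast
    field_simp
  -- Differentiation lowers the degree by one, and the term of degree zero contributes nothing.
  rw [← hasSum_nat_add_iff' 1]
  simpa [hsucc, (hP 0).diff_eq_zero] using (ContinuousLinearMap.apply ℝ (CD r) v).hasSum h2

theorem SuperDifferentiableAt.congr {f g : CD r → CD r} {y : CD r}
    (h : SuperDifferentiableAt f y) (hfg : f =ᶠ[𝓝 y] g) : SuperDifferentiableAt g y := by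
  obtain ⟨P, hP, ρ, hρ, hs⟩ := h
  -- Agreement is needed near each point `y + h`, not just at it, since derivatives are compared
  -- there.
  obtain ⟨ε, hε, hball⟩ := Metric.eventually_nhds_iff.1 hfg.eventually_nhds
  refine ⟨P, hP, min ρ ε, lt_min hρ hε, fun h hh => ?_⟩
  obtain ⟨h1, D, hD, hD'⟩ := hs h (hh.trans_le (min_le_left _ _))
  have heq := hball (y := y + h) (by simpa using hh.trans_le (min_le_right _ _))
  exact ⟨heq.self_of_nhds ▸ h1, D, hD.congr_of_eventuallyEq (Filter.EventuallyEq.symm heq), hD'⟩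

/-- The sum of a constant and a phrase of degree one is super-differentiable. -/
theorem CDPhrase.IsHomogeneous.superDifferentiableAt_const_add {P : CDPhrase r}
    (hP : P.IsHomogeneous 1) (c : CD r) :
    SuperDifferentiableAt (fun ζ => c + P.eval ζ) 0 := by
  obtain ⟨D, hD, hdiff⟩ := hP.exists_clm
  let Q : ℕ → CDPhrase r := fun n =>
    if n = 0 then Finsupp.single (.const c) 1 else if n = 1 then P else 0
  have hQ0 : Q 0 = Finsupp.single (.const c) 1 := rfl
  have hQ1 : Q 1 = P := rfl
  have hQ (n : ℕ) (hn : n ∉ Finset.range 2) : Q n = 0 := by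
    rw [Finset.mem_range] at hn
    simp only [Q]
    rw [if_neg (by lia), if_neg (by lia)]
  have hsum (F : CDPhrase r → CD r) (hF : F 0 = 0) :
      HasSum (fun n => F (Q n)) (F (Q 0) + F (Q 1)) := by
    have : HasSum (fun n => F (Q n)) (∑ n ∈ Finset.range 2, F (Q n)) :=
      hasSum_sum_of_ne_finset_zero fun n hn => by simp only [hQ n hn, hF]
    simpa [Finset.sum_range_succ] using this
  refine ⟨Q, fun n => ?_, 1, one_pos, fun h _ => ⟨?_, D, ?_, fun v => ?_⟩⟩
  · by_cases h0 : n = 0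
    · subst h0
      intro w hw
      rw [hQ0] at hw
      rw [Finset.mem_singleton.1 (Finsupp.support_single_subset hw)]
      rfl
    · by_cases h1 : n = 1
      · rw [h1]
        exact hP
      · rw [hQ n (by rw [Finset.mem_range]; lia)]
        exact isHomogeneous_zero n
  · have := hsum (fun P => P.eval h) (eval_zero h)
    rw [hQ0, hQ1] at this
    simpa [eval, CDWord.eval] using this
  · rw [hD]
    exact D.hasFDerivAt.const_add c
  · have := hsum (fun P => P.diff h v) (diff_zero h v)
    rw [hQ0, hQ1, hdiff] at this
    simpa [diff, CDWord.diff] using this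

end SuperDifferentiability

/-! ### Coordinates and block decomposition of `l₂` -/

namespace CDSpace

open scoped Topology

variable {r : ℕ} {ι κ : Type*}

theorem memℓp_iff {v : ι → CD r} : Memℓp v 2 ↔ Summable fun i => ‖v i‖ ^ (2 : ENNReal).toReal :=
  memℓp_gen_iff (by norm_num)

/-- Reindexing along an injective map, as a continuous linear map. -/
def restrict (σ : ι ↪ κ) : CDSpace r κ →L[ℝ] CDSpace r ι :=
  LinearMap.mkContinuous
    { toFun := fun v => ⟨fun i => v (σ i), memℓp_iff.2
        ((memℓp_iff.1 (lp.memℓp v)).comp_injective σ.injective)⟩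
      map_add' := fun _ _ => rfl
      map_smul' := fun _ _ => rfl } 1 fun v => by
    rw [one_mul]
    refine lp.norm_le_of_forall_sum_le (by norm_num) (norm_nonneg _) fun s => ?_
    have := lp.sum_rpow_le_norm_rpow (by norm_num) v (s.map σ)
    rwa [Finset.sum_map] at this

/-- The identification of `l₂(ι ⊕ κ, A_r)` with `l₂(ι, A_r) × l₂(κ, A_r)`. -/
def sumEquiv (r : ℕ) (ι κ : Type*) : CDSpace r (ι ⊕ κ) ≃L[ℝ] CDSpace r ι × CDSpace r κ :=
  LinearEquiv.toContinuousLinearEquivOfContinuous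
    { toLinearMap := ((restrict .inl).prod (restrict .inr) :
        CDSpace r (ι ⊕ κ) →L[ℝ] CDSpace r ι × CDSpace r κ).toLinearMap
      invFun := fun p => ⟨Sum.elim p.1 p.2, memℓp_iff.2 (Summable.sum _
        (memℓp_iff.1 (lp.memℓp p.1)) (memℓp_iff.1 (lp.memℓp p.2)))⟩
      left_inv := fun v => lp.ext (funext fun i => by cases i <;> rfl)
      right_inv := fun p => rfl }
    ((restrict .inl).prod (restrict .inr) :
        CDSpace r (ι ⊕ κ) →L[ℝ] CDSpace r ι × CDSpace r κ).continuous

theorem sumEquiv_fst (v : CDSpace r (ι ⊕ κ)) (i : ι) :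
    (sumEquiv r ι κ v).1 i = v (Sum.inl i) := rfl

theorem sumEquiv_snd (v : CDSpace r (ι ⊕ κ)) (i : κ) :
    (sumEquiv r ι κ v).2 i = v (Sum.inr i) := rfl

@[simp] theorem sumEquiv_symm_inl (p : CDSpace r ι × CDSpace r κ) (i : ι) :
    (sumEquiv r ι κ).symm p (Sum.inl i) = p.1 i := rfl

@[simp] theorem sumEquiv_symm_inr (p : CDSpace r ι × CDSpace r κ) (i : κ) :
    (sumEquiv r ι κ).symm p (Sum.inr i) = p.2 i := rfl

/-- The inclusion of a coordinate, as a continuous linear map. -/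
def coordL (r : ℕ) {ι : Type*} (k : ι) : CD r →L[ℝ] CDSpace r ι :=
  letI := Classical.decEq ι
  lp.singleContinuousLinearMap ℝ (fun _ : ι => CD r) 2 k

@[simp] theorem coordL_apply (k : ι) (ζ : CD r) : coordL r k ζ = coord k ζ := rfl

@[simp] theorem coord_zero (k : ι) : (coord k 0 : CDSpace r ι) = 0 := map_zero (coordL r k)

theorem coord_apply_self (k : ι) (ζ : CD r) : (coord k ζ : CDSpace r ι) k = ζ :=
  letI := Classical.decEq ι
  lp.single_apply_self _ _ _

theorem coord_apply_ne {k j : ι} (h : j ≠ k) (ζ : CD r) : (coord k ζ : CDSpace r ι) j = 0 :=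
  letI := Classical.decEq ι
  lp.single_apply_ne _ _ _ h

theorem sumEquiv_coord_inl (k : ι) (ζ : CD r) :
    sumEquiv r ι κ (coord (Sum.inl k) ζ) = (coord k ζ, 0) := by
  refine Prod.ext (lp.ext (funext fun i => ?_)) (lp.ext (funext fun i => ?_))
  · rw [sumEquiv_fst]
    by_cases h : i = k
    · rw [h, coord_apply_self, coord_apply_self]
    · rw [coord_apply_ne h, coord_apply_ne (by simpa using h)]
  · rw [sumEquiv_snd, coord_apply_ne (by simp)]
    rfl

theorem sumEquiv_coord_inr (k : κ) (ζ : CD r) :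
    sumEquiv r ι κ (coord (Sum.inr k) ζ) = (0, coord k ζ) := by
  refine Prod.ext (lp.ext (funext fun i => ?_)) (lp.ext (funext fun i => ?_))
  · rw [sumEquiv_fst, coord_apply_ne (by simp)]
    rfl
  · rw [sumEquiv_snd]
    by_cases h : i = k
    · rw [h, coord_apply_self, coord_apply_self]
    · rw [coord_apply_ne h, coord_apply_ne (by simpa using h)]

/-- The entry at `j`, as a continuous linear map. -/
def entryL (r : ℕ) {ι : Type*} (j : ι) : CDSpace r ι →L[ℝ] CD r :=
  lp.evalCLM ℝ (fun _ : ι => CD r) 2 j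

@[simp] theorem entryL_apply (j : ι) (v : CDSpace r ι) : entryL r j v = v j := rfl

end CDSpace

/-! ### Tangent maps of holomorphic maps -/

section Tangent

open scoped Topology
open CDSpace

variable {r : ℕ} {ι κ : Type*} {f : CDSpace r ι → CDSpace r κ} {U : Set (CDSpace r ι)}

theorem CDHolomorphicOn.congr {g : CDSpace r ι → CDSpace r κ} (hf : CDHolomorphicOn f U)
    (hU : IsOpen U) (hfg : Set.EqOn f g U) : CDHolomorphicOn g U := by
  intro z hz
  have heq : f =ᶠ[𝓝 z] g := Filter.eventuallyEq_of_mem (hU.mem_nhds hz) hfg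
  refine ⟨(hf z hz).1.congr heq, fun j k => ((hf z hz).2 j k).congr ?_⟩
  have ht : Filter.Tendsto (fun ζ => z + coordL r k ζ) (𝓝 0) (𝓝 z) := by
    have : Continuous fun ζ => z + coordL r k ζ := by fun_prop
    simpa using this.tendsto 0
  filter_upwards [ht.eventually heq] with ζ hζ
  exact congrArg (fun v : CDSpace r κ => v j) hζ

theorem CDHolomorphicOn.analyticAt_entry (hf : CDHolomorphicOn f U) {z : CDSpace r ι}
    (hz : z ∈ U) (j : κ) : AnalyticAt ℝ (fun w => f w j) z :=
  ((entryL r j).analyticAt _).comp (hf z hz).1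

/-- The Taylor terms of an entry in a Cayley-Dickson variable are phrases. -/
theorem CDHolomorphicOn.iteratedFDeriv_mem (hf : CDHolomorphicOn f U) {z : CDSpace r ι}
    (hz : z ∈ U) (j : κ) (k : ι) (n : ℕ) :
    (iteratedFDeriv ℝ n (fun w => f w j) z).compContinuousLinearMap (fun _ => coordL r k) ∈
      phraseMultilinear r n := by
  have ha := hf.analyticAt_entry hz j
  have hc : AnalyticAt ℝ (fun ζ => f (z + coordL r k ζ) j) 0 :=
    AnalyticAt.fun_comp (g := fun w => f w j) (by simpa using ha) (analyticAt_const.add ((coordL r k).analyticAt 0))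
  have hm := SuperDifferentiableAt.iteratedFDeriv_mem ((hf z hz).2 j k) hc n
  obtain ⟨P, hP, h⟩ := hm
  exact ⟨P, hP, fun ζ => (ha.iteratedFDeriv_comp_affine (coordL r k) n ζ).symm.trans (h ζ)⟩

theorem CDHolomorphicOn.fderiv_entry (hf : CDHolomorphicOn f U) {z : CDSpace r ι}
    (hz : z ∈ U) (j : κ) (v : CDSpace r ι) :
    fderiv ℝ (fun w => f w j) z v = fderiv ℝ f z v j := by
  have := (entryL r j).hasFDerivAt.comp z (hf z hz).1.differentiableAt.hasFDerivAt
  exact congrArg (fun T => T v) this.fderiv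

/-- The differential of a holomorphic map is superlinear. -/
theorem CDHolomorphicOn.isSuperlinear_fderiv (hf : CDHolomorphicOn f U) {z : CDSpace r ι}
    (hz : z ∈ U) : IsSuperlinear (fderiv ℝ f z) := by
  intro j k
  obtain ⟨P, hP, h⟩ := hf.iteratedFDeriv_mem hz j k 1
  refine ⟨P, hP, fun ζ => ?_⟩
  rw [← h ζ, ← hf.fderiv_entry hz]
  simp

/-- A directional derivative of an entry is super-differentiable in each variable. -/
theorem CDHolomorphicOn.superDifferentiableAt_fderiv (hU : IsOpen U) (hf : CDHolomorphicOn f U)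
    {z : CDSpace r ι} (hz : z ∈ U) (j : κ) (k : ι) (v : CDSpace r ι) :
    SuperDifferentiableAt (fun ζ => fderiv ℝ f (z + coord k ζ) v j) 0 := by
  have ha := hf.analyticAt_entry hz j
  have hG : AnalyticAt ℝ (fun w => fderiv ℝ (fun w => f w j) w v) z :=
    ((ContinuousLinearMap.apply ℝ (CD r) v).analyticAt _).comp ha.fderiv
  have ht : Filter.Tendsto (fun ζ => z + coordL r k ζ) (𝓝 0) (𝓝 z) := by
    have : Continuous fun ζ => z + coordL r k ζ := by fun_prop
    simpa using this.tendsto 0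
  have hc : AnalyticAt ℝ (fun ζ => fderiv ℝ (fun w => f w j) (z + coordL r k ζ) v) 0 :=
    AnalyticAt.fun_comp (g := fun w => fderiv ℝ (fun w => f w j) w v) (by simpa using hG)
      (analyticAt_const.add ((coordL r k).analyticAt 0))
  refine (hc.superDifferentiableAt fun n => ?_).congr ?_
  -- For small `t` the point `z + t • v` lies in `U`, so the Taylor terms there in the `k`-th
  -- variable are phrases. Their derivative at `t = 0` is a limit of difference quotients inside the
  -- closed subspace `phraseMultilinear r n`.
  · have hmem : (fderiv ℝ (iteratedFDeriv ℝ n fun w => f w j) z v).compContinuousLinearMap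
        (fun _ => coordL r k) ∈ phraseMultilinear r n := by
      let T : (CDSpace r ι [×n]→L[ℝ] CD r) →L[ℝ] CD r [×n]→L[ℝ] CD r :=
        ContinuousMultilinearMap.compContinuousLinearMapL fun _ => coordL r k
      have hd : DifferentiableAt ℝ (iteratedFDeriv ℝ n fun w => f w j) z := by
        have : ContDiffAt ℝ (1 : ℕ) (iteratedFDeriv ℝ n fun w => f w j) z :=
          ha.contDiffAt.iteratedFDeriv_right (n := ω) le_top
        exact this.differentiableAt (by simp)
      have hl : HasDerivAt (fun t : ℝ => z + t • v) v 0 := by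
        simpa using ((hasDerivAt_id (0 : ℝ)).smul_const v).const_add z
      have hd' : HasDerivAt (fun t : ℝ => T (iteratedFDeriv ℝ n (fun w => f w j) (z + t • v)))
          (T (fderiv ℝ (iteratedFDeriv ℝ n fun w => f w j) z v)) 0 := by
        refine T.hasFDerivAt.comp_hasDerivAt (0 : ℝ) ?_
        exact HasFDerivAt.comp_hasDerivAt (l := iteratedFDeriv ℝ n fun w => f w j) (0 : ℝ)
          (by simpa using hd.hasFDerivAt) hl
      have hev : ∀ᶠ t : ℝ in 𝓝 0, z + t • v ∈ U := by
        refine hl.continuousAt.eventually_mem ?_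
        simpa using hU.mem_nhds hz
      have hmemU (t : ℝ) (h : z + t • v ∈ U) :
          T (iteratedFDeriv ℝ n (fun w => f w j) (z + t • v)) ∈ phraseMultilinear r n :=
        hf.iteratedFDeriv_mem h j k n
      refine (isClosed_phraseMultilinear r n).mem_of_tendsto hd'.tendsto_slope_zero ?_
      filter_upwards [nhdsWithin_le_nhds hev] with t ht
      refine (phraseMultilinear r n).smul_mem _ ((phraseMultilinear r n).sub_mem ?_ ?_)
      · simpa using hmemU t ht
      · exact hmemU 0 (by simpa using hz)
    obtain ⟨P, hP, h⟩ := hmem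
    refine ⟨P, hP, fun ζ => ?_⟩
    rw [← h ζ]
    exact (hG.iteratedFDeriv_comp_affine (coordL r k) n ζ).trans
      (ha.iteratedFDeriv_fderiv_apply n (coordL r k ζ) v)
  · filter_upwards [ht.eventually (hU.mem_nhds hz)] with ζ hζ
    exact hf.fderiv_entry hζ j v

/-- The tangent map of a holomorphic map is holomorphic. -/
theorem CDHolomorphicOn.tangentMap (hU : IsOpen U) (hf : CDHolomorphicOn f U) :
    CDHolomorphicOn (fun w => (sumEquiv r κ κ).symm
      (f (sumEquiv r ι ι w).1, fderiv ℝ f (sumEquiv r ι ι w).1 (sumEquiv r ι ι w).2))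
      {w | (sumEquiv r ι ι w).1 ∈ U} := by
  intro w hw
  have hw : (sumEquiv r ι ι w).1 ∈ U := hw
  constructor
  · have hΨ : AnalyticAt ℝ (sumEquiv r ι ι) w :=
      (sumEquiv r ι ι).toContinuousLinearMap.analyticAt w
    have h1 : AnalyticAt ℝ (fun w => (sumEquiv r ι ι w).1) w := analyticAt_fst.comp hΨ
    have h2 : AnalyticAt ℝ (fun w => (sumEquiv r ι ι w).2) w := analyticAt_snd.comp hΨ
    have hfa := (hf _ hw).1
    have h3 : AnalyticAt ℝ (fun w => fderiv ℝ f (sumEquiv r ι ι w).1) w :=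
      AnalyticAt.comp (g := fderiv ℝ f) hfa.fderiv h1
    have h4 : AnalyticAt ℝ (fun w => f (sumEquiv r ι ι w).1) w := AnalyticAt.comp (g := f) hfa h1
    exact ((sumEquiv r κ κ).symm.toContinuousLinearMap.analyticAt _).comp
      (h4.prod (AnalyticAt.comp
        ((ContinuousLinearMap.id ℝ (CDSpace r ι →L[ℝ] CDSpace r κ)).analyticAt_bilinear _)
        (h3.prod h2)))
  -- The component `f z` is holomorphic in `z` and constant in `v`; the component `f'(z) v` is a
  -- directional derivative as a function of `z`, and a constant plus a phrase of degree one as a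
  -- function of an entry of `v`.
  · rintro (j | j) (k | k)
    · simpa [sumEquiv_coord_inl] using (hf _ hw).2 j k
    · have := (CDPhrase.isHomogeneous_zero (r := r) 1).superDifferentiableAt_const_add
        (f (sumEquiv r ι ι w).1 j)
      simpa [sumEquiv_coord_inr] using this
    · simpa [sumEquiv_coord_inl] using
        hf.superDifferentiableAt_fderiv hU hw j k (sumEquiv r ι ι w).2
    · obtain ⟨P, hP, h⟩ := hf.isSuperlinear_fderiv hw j k
      have := hP.superDifferentiableAt_const_add
        (fderiv ℝ f (sumEquiv r ι ι w).1 (sumEquiv r ι ι w).2 j)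
      simpa [sumEquiv_coord_inr, ← h] using this

end Tangent

/-! ### Vector spaces over `A_r` -/

section VectorSpace

variable {r : ℕ} {ι : Type*}

namespace CDSpace

/-- A real linear map of the entries, applied to all entries. -/
def mapEntries (T : CD r →L[ℝ] CD r) : CDSpace r ι →ₗ[ℝ] CDSpace r ι where
  toFun v := ⟨fun i => T (v i), ((lp.memℓp v).const_smul ‖T‖).mono' fun i => by
    simpa [norm_smul] using T.le_opNorm (v i)⟩
  map_add' v w := lp.ext (funext fun i => map_add T (v i) (w i))
  map_smul' c v := lp.ext (funext fun i => map_smul T c (v i))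

@[simp] theorem mapEntries_apply (T : CD r →L[ℝ] CD r) (v : CDSpace r ι) (i : ι) :
    mapEntries T v i = T (v i) := rfl

theorem sum_apply {α : Type*} (s : Finset α) (f : α → CDSpace r ι) (i : ι) :
    (∑ a ∈ s, f a) i = ∑ a ∈ s, f a i :=
  map_sum (entryL r i) f s

/-- The entrywise structure of an `A_r`-vector space on `l₂(ι, A_r)`. -/
def vectorSpace (r : ℕ) (ι : Type*) : CDVectorSpace r (CDSpace r ι) where
  lsmul := LinearMap.mk₂ ℝ (fun a v => mapEntries (CD.mulL r a) v)
    (fun a b v => lp.ext (funext fun i => by simp))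
    (fun c a v => lp.ext (funext fun i => by simp))
    (fun a v w => map_add _ v w) (fun c a v => map_smul _ c v)
  rsmul := LinearMap.mk₂ ℝ (fun a v => mapEntries ((CD.mulL r).flip a) v)
    (fun a b v => lp.ext (funext fun i => by simp))
    (fun c a v => lp.ext (funext fun i => by simp))
    (fun a v w => map_add _ v w) (fun c a v => map_smul _ c v)
  one_lsmul v := lp.ext (funext fun i => CD.one_mul' (v i))
  one_rsmul v := lp.ext (funext fun i => CD.mul_one' (v i))
  -- Vectors with real entries: real multiples of `1` commute and associate with all of `A_r`.
  core :=
    { carrier := {v | ∀ i, ∃ t : ℝ, v i = t • (1 : CD r)}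
      add_mem' := fun hv hw i => by
        obtain ⟨s, hs⟩ := hv i
        obtain ⟨t, ht⟩ := hw i
        exact ⟨s + t, by simp [hs, ht, add_smul]⟩
      zero_mem' := fun i => ⟨0, by simp⟩
      smul_mem' := fun c v hv i => by
        obtain ⟨s, hs⟩ := hv i
        exact ⟨c * s, by simp [hs, mul_smul]⟩ }
  lsmul_core a b v hv := lp.ext (funext fun i => by
    obtain ⟨t, ht⟩ := hv i
    simp [ht, CD.one_mul'])
  rsmul_core a b v hv := lp.ext (funext fun i => by
    obtain ⟨t, ht⟩ := hv i
    simp [ht, CD.one_mul'])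
  decomposition v := by
    -- The sum recovers each coefficient as a real coordinate of an entry, which gives both
    -- existence and uniqueness.
    have key (c : CDIndex r → CDSpace r ι) (t : CDIndex r → ι → ℝ)
        (hc : ∀ k i, c k i = t k i • (1 : CD r)) (i : ι) (j : CDIndex r) :
        (∑ k, mapEntries ((CD.mulL r).flip (CD.gen r k)) (c k)) i j = t j i := by
      rw [sum_apply]
      simp [hc, CD.one_mul', CD.gen, Finset.sum_apply, Pi.single_apply]
    refine ⟨fun k => ⟨mapEntries ((EuclideanSpace.proj k : CD r →L[ℝ] ℝ).smulRight 1) v,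
      fun i => ⟨v i k, rfl⟩⟩, ?_, ?_⟩
    · refine lp.ext (funext fun i => PiLp.ext fun j => ?_)
      exact (key _ (fun k i => v i k) (fun k i => rfl) i j).symm
    · intro c hc
      choose t ht using fun k => (c k).2
      refine funext fun k => Subtype.ext (lp.ext (funext fun i => ?_))
      have h := key (fun k => c k) t ht i k
      have hv : v i k = t k i := by
        rw [← h]
        exact congrArg (fun w : CDSpace r ι => w i k) hc
      rw [ht k i, ← hv]
      rfl

end CDSpace

/-- Transport of the structure of an `A_r`-vector space along a linear equivalence. -/
def CDVectorSpace.transport {V W : Type*} [AddCommGroup V] [Module ℝ V] [AddCommGroup W]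
    [Module ℝ W] (S : CDVectorSpace r W) (θ : V ≃ₗ[ℝ] W) : CDVectorSpace r V where
  lsmul := LinearMap.mk₂ ℝ (fun a v => θ.symm (S.lsmul a (θ v))) (by simp) (by simp) (by simp)
    (by simp)
  rsmul := LinearMap.mk₂ ℝ (fun a v => θ.symm (S.rsmul a (θ v))) (by simp) (by simp) (by simp)
    (by simp)
  one_lsmul v := by simp [S.one_lsmul]
  one_rsmul v := by simp [S.one_rsmul]
  core := S.core.comap θ.toLinearMap
  lsmul_core a b v hv := by simpa using S.lsmul_core a b (θ v) hv
  rsmul_core a b v hv := by simpa using S.rsmul_core a b (θ v) hv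
  decomposition v := by
    obtain ⟨c, hc, huniq⟩ := S.decomposition (θ v)
    refine ⟨fun k => ⟨θ.symm (c k), by simp⟩, ?_, fun d hd => ?_⟩
    · apply θ.injective
      simpa using hc
    · have := huniq (fun k => ⟨θ (d k), (d k).2⟩) (by
        have := congrArg θ hd
        simpa using this)
      funext k
      apply Subtype.ext
      simp [← this]

end VectorSpace

/-! ### Charts of the tangent bundle -/

section Manifold

open CDSpace
open scoped Topology

variable {r : ℕ} {ι : Type*} {M : Type*} [TopologicalSpace M] [ChartedSpace (CDSpace r ι) M]

/-- A holomorphic manifold is a smooth real manifold. -/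
theorem IsCDManifold.isManifold (hM : IsCDManifold r ι M) (n : ℕ∞ω) :
    IsManifold 𝓘(ℝ, CDSpace r ι) n M := by
  refine isManifold_of_contDiffOn _ _ _ fun e e' he he' => ?_
  intro z hz
  have hz' : z ∈ (e.symm.trans e').source := by simpa using hz
  have := (hM.holomorphic e he e' he' z hz').1
  exact (this.contDiffAt (n := n)).contDiffWithinAt

variable [IsManifold 𝓘(ℝ, CDSpace r ι) 1 M]

/-- The chart of the tangent bundle induced by a chart. -/
def tangentChart (e : atlas (CDSpace r ι) M) :
    OpenPartialHomeomorph (TangentBundle 𝓘(ℝ, CDSpace r ι) M) (CDSpace r (ι ⊕ ι)) :=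
  (((tangentBundleCore 𝓘(ℝ, CDSpace r ι) M).localTriv e).toOpenPartialHomeomorph.trans
    (e.1.prod (OpenPartialHomeomorph.refl (CDSpace r ι)))).trans
    (sumEquiv r ι ι).symm.toHomeomorph.toOpenPartialHomeomorph

theorem tangentChart_source (e : atlas (CDSpace r ι) M) :
    (tangentChart e).source = {p | p.proj ∈ e.1.source} := by
  ext p
  have hp := (tangentBundleCore 𝓘(ℝ, CDSpace r ι) M).mem_localTriv_source e p
  simp only [tangentChart, OpenPartialHomeomorph.trans_toPartialEquiv]
  constructor
  · intro h
    exact hp.1 h.1.1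
  · intro h
    exact ⟨⟨hp.2 h, h, trivial⟩, trivial⟩

theorem mem_tangentChart_target (e : atlas (CDSpace r ι) M) (w : CDSpace r (ι ⊕ ι)) :
    w ∈ (tangentChart e).target ↔ (sumEquiv r ι ι w).1 ∈ e.1.target := by
  simpa [tangentChart] using e.1.map_target

theorem tangentChart_apply (e : atlas (CDSpace r ι) M)
    (p : TangentBundle 𝓘(ℝ, CDSpace r ι) M) :
    tangentChart e p = (sumEquiv r ι ι).symm (e.1 p.proj,
      (tangentBundleCore 𝓘(ℝ, CDSpace r ι) M).coordChange (achart _ p.proj) e p.proj p.snd) :=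
  rfl

theorem tangentBundleCore_coordChange_eq (e e' : atlas (CDSpace r ι) M) (x : M) :
    (tangentBundleCore 𝓘(ℝ, CDSpace r ι) M).coordChange e e' x =
      fderiv ℝ (e.1.symm.trans e'.1) (e.1 x) := by
  rw [← fderivWithin_univ, ← ModelWithCorners.range_eq_univ 𝓘(ℝ, CDSpace r ι)]
  rfl

/-- A tangent vector at `x` is stored as its coordinates in the preferred chart at `x`, so the
differential of `e` is the coordinate change from that chart. -/
theorem chartDifferential_eq (e : atlas (CDSpace r ι) M) {x : M} (hx : x ∈ e.1.source) :
    chartDifferential e.1 x =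
      (tangentBundleCore 𝓘(ℝ, CDSpace r ι) M).coordChange (achart _ x) e x := by
  have h := mdifferentiableAt_atlas (I := 𝓘(ℝ, CDSpace r ι)) e.2 hx
  rw [chartDifferential, h.mfderiv]
  rfl

/-- The cocycle identity for the preferred chart at `x`, `e` and `e'`. -/
theorem fderiv_chartDifferential (e e' : atlas (CDSpace r ι) M) {x : M} (hx : x ∈ e.1.source)
    (hx' : x ∈ e'.1.source) (v : TangentSpace 𝓘(ℝ, CDSpace r ι) x) :
    fderiv ℝ (e.1.symm.trans e'.1) (e.1 x) (chartDifferential e.1 x v) =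
      chartDifferential e'.1 x v := by
  rw [chartDifferential_eq e hx, chartDifferential_eq e' hx', ← tangentBundleCore_coordChange_eq]
  exact (tangentBundleCore 𝓘(ℝ, CDSpace r ι) M).coordChange_comp _ _ _ x
    ⟨⟨mem_chart_source _ x, hx⟩, hx'⟩ v

theorem isTangentChart_tangentChart (e : atlas (CDSpace r ι) M) :
    IsTangentChart e.1 (tangentChart e) := by
  refine ⟨tangentChart_source e, fun p hp k => ?_⟩
  rw [tangentChart_source] at hp
  rw [chartDifferential_eq e hp, tangentChart_apply]
  exact ⟨rfl, rfl⟩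

theorem tangentChart_apply_eq (e : atlas (CDSpace r ι) M)
    {p : TangentBundle 𝓘(ℝ, CDSpace r ι) M} (hp : p.proj ∈ e.1.source) :
    tangentChart e p =
      (sumEquiv r ι ι).symm (e.1 p.proj, chartDifferential e.1 p.proj p.snd) := by
  rw [chartDifferential_eq e hp, tangentChart_apply]
  rfl

theorem mem_tangentChart_symm_trans_source (e e' : atlas (CDSpace r ι) M)
    (w : CDSpace r (ι ⊕ ι)) :
    w ∈ ((tangentChart e).symm.trans (tangentChart e')).source ↔
      (sumEquiv r ι ι w).1 ∈ (e.1.symm.trans e'.1).source := by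
  rw [OpenPartialHomeomorph.trans_source, OpenPartialHomeomorph.trans_source]
  simp only [OpenPartialHomeomorph.symm_source, Set.mem_inter_iff, Set.mem_preimage,
    mem_tangentChart_target, tangentChart_source]
  rfl

/-- The chain rule in charts, in the form to which `CDHolomorphicOn.tangentMap` applies. -/
theorem tangentChart_symm_trans_apply (e e' : atlas (CDSpace r ι) M) {w : CDSpace r (ι ⊕ ι)}
    (hw : (sumEquiv r ι ι w).1 ∈ (e.1.symm.trans e'.1).source) :
    (tangentChart e).symm.trans (tangentChart e') w = (sumEquiv r ι ι).symm
      ((e.1.symm.trans e'.1) (sumEquiv r ι ι w).1,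
        fderiv ℝ (e.1.symm.trans e'.1) (sumEquiv r ι ι w).1 (sumEquiv r ι ι w).2) := by
  rw [OpenPartialHomeomorph.trans_source] at hw
  obtain ⟨h1, h2⟩ := hw
  have h1 : (sumEquiv r ι ι w).1 ∈ e.1.target := h1
  have hw := (tangentChart e).right_inv ((mem_tangentChart_target e w).2 h1)
  rw [OpenPartialHomeomorph.coe_trans, Function.comp_apply]
  set p := (tangentChart e).symm w
  have hp' : p.proj ∈ e'.1.source := h2
  have hp : p.proj ∈ e.1.source := e.1.map_target h1
  rw [tangentChart_apply_eq e hp] at hw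
  rw [tangentChart_apply_eq e' hp', ← hw, ContinuousLinearEquiv.apply_symm_apply,
    fderiv_chartDifferential e e' hp hp', OpenPartialHomeomorph.coe_trans, Function.comp_apply,
    e.1.left_inv hp]

/-- Vectors over one point lie in the domain of a common chart `Te` and are separated in the model
space; vectors over different points are separated by preimages of open sets of `M`. -/
theorem tangentBundle_t2Space [T2Space M] :
    T2Space (TangentBundle 𝓘(ℝ, CDSpace r ι) M) := by
  refine ⟨fun p q hpq => ?_⟩
  by_cases h : p.proj = q.proj
  · have hp : p ∈ (tangentChart (achart (CDSpace r ι) p.proj)).source := by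
      rw [tangentChart_source]
      exact mem_chart_source _ p.proj
    have hq : q ∈ (tangentChart (achart (CDSpace r ι) p.proj)).source := by
      rw [tangentChart_source, Set.mem_ofPred_eq, ← h]
      exact mem_chart_source _ p.proj
    set E := tangentChart (achart (CDSpace r ι) p.proj)
    obtain ⟨u, v, hu, hv, hpu, hqv, huv⟩ := t2_separation fun heq => hpq (E.injOn hp hq heq)
    exact ⟨_, _, E.isOpen_inter_preimage hu, E.isOpen_inter_preimage hv, ⟨hp, hpu⟩, ⟨hq, hqv⟩,
      (huv.preimage E).mono Set.inter_subset_right Set.inter_subset_right⟩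
  · obtain ⟨u, v, hu, hv, hpu, hqv, huv⟩ := t2_separation h
    have hc := FiberBundle.continuous_proj (CDSpace r ι)
      (TangentSpace 𝓘(ℝ, CDSpace r ι) : M → Type _)
    exact ⟨_, _, hu.preimage hc, hv.preimage hc, hpu, hqv, huv.preimage _⟩

/-- The charted space structure of the tangent bundle given by the charts `Te`. -/
@[reducible] def tangentChartedSpace :
    ChartedSpace (CDSpace r (ι ⊕ ι)) (TangentBundle 𝓘(ℝ, CDSpace r ι) M) where
  atlas := Set.range tangentChart
  chartAt p := tangentChart (achart _ p.proj)
  mem_chart_source p := by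
    rw [tangentChart_source]
    exact mem_chart_source _ p.proj
  chart_mem_atlas p := ⟨_, rfl⟩

/-- The tangent bundle, with the charts `Te`, is a holomorphic manifold. -/
theorem IsCDManifold.tangentBundle (hM : IsCDManifold r ι M) :
    letI := tangentChartedSpace (r := r) (ι := ι) (M := M)
    IsCDManifold r (ι ⊕ ι) (TangentBundle 𝓘(ℝ, CDSpace r ι) M) := by
  let := tangentChartedSpace (r := r) (ι := ι) (M := M)
  have := hM.t2
  refine ⟨tangentBundle_t2Space, ?_⟩
  rintro _ ⟨e, rfl⟩ _ ⟨e', rfl⟩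
  have hsource : ((tangentChart e).symm.trans (tangentChart e')).source =
      {w | (sumEquiv r ι ι w).1 ∈ (e.1.symm.trans e'.1).source} :=
    Set.ext (mem_tangentChart_symm_trans_source e e')
  have h := (hM.holomorphic e.1 e.2 e'.1 e'.2).tangentMap (e.1.symm.trans e'.1).open_source
  rw [← hsource] at h
  refine h.congr ((tangentChart e).symm.trans (tangentChart e')).open_source fun w hw => ?_
  exact (tangentChart_symm_trans_apply e e'
    ((mem_tangentChart_symm_trans_source e e' w).1 hw)).symm

theorem chartDifferential_comp_symm {e e' : OpenPartialHomeomorph M (CDSpace r ι)}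
    (he : e ∈ atlas (CDSpace r ι) M) (he' : e' ∈ atlas (CDSpace r ι) M) {x : M}
    (hx : x ∈ e.source) (hx' : x ∈ e'.source)
    (θ : TangentSpace 𝓘(ℝ, CDSpace r ι) x ≃L[ℝ] CDSpace r ι)
    (hθ : (θ : TangentSpace 𝓘(ℝ, CDSpace r ι) x →L[ℝ] CDSpace r ι) = chartDifferential e x) :
    (chartDifferential e' x).comp
        (θ.symm : CDSpace r ι →L[ℝ] TangentSpace 𝓘(ℝ, CDSpace r ι) x) =
      fderiv ℝ (e.symm.trans e') (e x) := by
  ext1 v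
  have h := fderiv_chartDifferential ⟨e, he⟩ ⟨e', he'⟩ hx hx' (θ.symm v)
  rw [← hθ] at h
  simpa using h.symm

end Manifold

end

/-! ### The proposition -/

theorem proposition4 (r : ℕ) {ι : Type*} {M : Type*} [TopologicalSpace M]
    [ChartedSpace (CDSpace r ι) M] (hM : IsCDManifold r ι M) :
    ∃ _ : IsManifold 𝓘(ℝ, CDSpace r ι) ∞ M,
      -- the tangent bundle is a holomorphic manifold, with the atlas of all charts `Te`
      (∃ _ : ChartedSpace (CDSpace r (ι ⊕ ι)) (TangentBundle 𝓘(ℝ, CDSpace r ι) M),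
        IsCDManifold r (ι ⊕ ι) (TangentBundle 𝓘(ℝ, CDSpace r ι) M) ∧
        (∀ e ∈ atlas (CDSpace r ι) M,
          ∃ E ∈ atlas (CDSpace r (ι ⊕ ι)) (TangentBundle 𝓘(ℝ, CDSpace r ι) M),
            IsTangentChart e E) ∧
        (∀ E ∈ atlas (CDSpace r (ι ⊕ ι)) (TangentBundle 𝓘(ℝ, CDSpace r ι) M),
          ∃ e ∈ atlas (CDSpace r ι) M, IsTangentChart e E)) ∧
      -- every chart at `x` makes `T_xM` a vector space over `A_r` isomorphic to the model space,
      -- and any two charts at `x` differ on `T_xM` by a superlinear map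
      ∀ x : M, ∀ e ∈ atlas (CDSpace r ι) M, x ∈ e.source →
        ∃ (S : CDVectorSpace r (TangentSpace 𝓘(ℝ, CDSpace r ι) x))
          (θ : TangentSpace 𝓘(ℝ, CDSpace r ι) x ≃L[ℝ] CDSpace r ι),
          (θ : TangentSpace 𝓘(ℝ, CDSpace r ι) x →L[ℝ] CDSpace r ι) = chartDifferential e x ∧
          (∀ (a : CD r) (v : TangentSpace 𝓘(ℝ, CDSpace r ι) x) (k : ι),
            θ (S.lsmul a v) k = a * θ v k ∧ θ (S.rsmul a v) k = θ v k * a) ∧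
          ∀ e' ∈ atlas (CDSpace r ι) M, x ∈ e'.source →
            IsSuperlinear ((chartDifferential e' x).comp
              (θ.symm : CDSpace r ι →L[ℝ] TangentSpace 𝓘(ℝ, CDSpace r ι) x)) := by
  have hman := hM.isManifold ∞
  have : IsManifold 𝓘(ℝ, CDSpace r ι) 1 M := hM.isManifold 1
  refine ⟨hman, ⟨tangentChartedSpace, hM.tangentBundle, fun e he => ?_, ?_⟩, fun x e he hx => ?_⟩
  · exact ⟨_, ⟨⟨e, he⟩, rfl⟩, isTangentChart_tangentChart ⟨e, he⟩⟩
  · rintro _ ⟨e, rfl⟩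
    exact ⟨e, e.2, isTangentChart_tangentChart e⟩
  · let θ : TangentSpace 𝓘(ℝ, CDSpace r ι) x ≃L[ℝ] CDSpace r ι :=
      (mdifferentiable_of_mem_atlas (I := 𝓘(ℝ, CDSpace r ι)) he).mfderiv hx
    have hθ : (θ : TangentSpace 𝓘(ℝ, CDSpace r ι) x →L[ℝ] CDSpace r ι) =
      chartDifferential e x := rfl
    refine ⟨(CDSpace.vectorSpace r ι).transport θ.toLinearEquiv, θ, hθ, fun a v k => ⟨?_, ?_⟩,
      fun e' he' hx' => ?_⟩
    · exact congrArg (fun w : CDSpace r ι => w k)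
        (θ.apply_symm_apply ((CDSpace.vectorSpace r ι).lsmul a (θ v)))
    · exact congrArg (fun w : CDSpace r ι => w k)
        (θ.apply_symm_apply ((CDSpace.vectorSpace r ι).rsmul a (θ v)))
    -- The comparison of the two charts on the fibre is the derivative of their transition map at `e
    -- x`, which is superlinear.
    · rw [chartDifferential_comp_symm he he' hx hx' θ hθ]
      refine (hM.holomorphic e he e' he').isSuperlinear_fderiv ?_
      rw [OpenPartialHomeomorph.trans_source]
      refine ⟨e.map_source hx, ?_⟩
      rw [Set.mem_preimage, e.left_inv hx]
      exact hx'
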